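/- **Setting.** Fix levels $z_U<z_F<z_E$, areas $A_E,A_U>0$, and constants $v_{\rm term},d_{\rm cap},n_S,v_\infty>0$, $n_{RZ}>1$, $0<\phi_c<1$, $n_b\ge 1+2n_S$, $1/(n_S+1)<\phi_c$. For $0\le\phi\le 1$ let $j_b(\phi)=\phi\,\tilde v(\phi)$, where $\tilde v(\phi)=v_{\rm term}(1-\phi)^{n_b}$ for $\phi\le\phi_c$ and $\tilde v(\phi)=v_{\rm drain}(1-\phi)^{2n_S+1}$ for $\phi>\phi_c$, with $v_{\rm drain}=v_{\rm term}(1-\phi_c)^{n_b-1-2n_S}$; let $d(\phi)=0$ for $\phi\le\phi_c$, $d(\phi)=v_{\rm drain}d_{\rm cap}\,\phi(1-\phi)^{n_S}$ for $\phi>\phi_c$, and $D(\phi)=\int_0^\phi d$; let $f_b(u)=v_\infty u(1-u)^{n_{RZ}}$. Let $Q_F>0$, $Q_U,Q_W\ge0$, $Q_E:=Q_W+Q_F-Q_U>0$, $\phi_F,\psi_F\ge0$, $\phi_F+\psi_F\le1$. Put $q_1=-Q_U/A_U$, $q_2=(Q_F-Q_U)/A_E$, $q_E=Q_E/A_E$,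 $s_F=Q_F\phi_F/A_E$, $\phi_E=Q_F\phi_F/Q_E$, and $$j(\phi;q)=j_b(\phi)+q\phi,\qquad j_k=j(\cdot;q_k),\qquad f(u,\phi;q)=(1-\phi)f_b(u)+\bigl(j_b(\phi)-(1-\phi)q\bigr)u .$$ Write $f_1(u,0;q)=f(u,0;q)$. Let $A(z)=A_E$ for $z\ge z_F$ and $A_U$ for $z<z_F$, and let $\gamma$ be the characteristic function of $[z_U,z_E)$. On the zones $z\ge z_E$, $[z_F,z_E)$, $[z_U,z_F)$, $z<z_U$ the flux $J(\phi,z)$ is $q_E\phi$, $j_2(\phi)$, $j_1(\phi)$, $q_1\phi$, and $F(u,\phi,z)$ is $-(1-\phi)q_Eu$, $f(u,\phi;q_2)$, $f(u,\phi;q_1)$, $-(1-\phi)q_1u$; $\tilde F(\psi,\phi,z)=F(\psi/(1-\phi),\phi,z)$ for $\phi<1$ and $0$ for $\phi=1$. A *stationary solution* is a pair of functions $\phi,\psi\ge0$, $\phi+\psi\le1$, on $\mathbb R$ such that $D(\phi)$ has an integrable weak derivative on $(z_U,z_E)$ and, in the sense of distributions on $\mathbb R$, $$\frac{d}{dz}\left(A\begin{pmatrix}J(\phi,z)\\-\tilde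 F(\psi,\phi,z)\end{pmatrix}-A\gamma\,\frac{dD(\phi)}{dz}\begin{pmatrix}1\\-\psi/(1-\phi)\end{pmatrix}\right)=Q_F\begin{pmatrix}\phi_F\\\psi_F\end{pmatrix}\delta_{z_F}.$$ Its aggregate profile $\phi$ is *admissible* if it has a left limit $\phi_U$ at $z_U$ and the following holds at each height $z_0$ where $\phi$ has one-sided limits $u_L\ne u_R$ (below and above). Put $c=-Q_U\phi_U$ (the constant mass flux) and let $g_L(v)$, $g_R(v)$ be the limits as $z\to z_0^\mp$ of $A(z)J(v,z)-Q_F\phi_F\mathbf 1_{z\ge z_F}$. If $z_0\notin\{z_U,z_F,z_E\}$ (then $g_L=g_R=g$): $g>c$ on $(u_L,u_R)$ if $u_L<u_R$, and $g<c$ on $(u_R,u_L)$ if $u_R<u_L$. If $z_0\in\{z_U,z_F,z_E\}$: there is $u_0$ between $u_L$ and $u_R$ (inclusive) such that, if $u_L<u_R$, $g_L\ge c$ on $[u_L,u_0]$ and $g_R\ge c$ on $[u_0,u_R]$, and, if $u_R<u_L$, $g_L\le c$ on $[u_0,u_L]$ and $g_R\le c$ on $[u_R,u_0]$. *Characteristic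 points.* Let $\phi_{\rm infl}=2/(n_b+1)$ and $\bar{\bar q}=-j_b'(\phi_{\rm infl})$. Let $\phi^M(q)$ be $0$ if $q\le-j_b'(0)$, the solution of $j_b'(\phi)=-q$ in $(0,\phi_{\rm infl})$ if $-j_b'(0)<q<\bar{\bar q}$, and $\phi_{\rm infl}$ otherwise. Let $\phi_M(q)$ be the local minimum point in $(\phi_{\rm infl},1]$ of $j(\cdot;q)$ on $[0,1]$ if $q<\bar{\bar q}$, and $\phi_{\rm infl}$ otherwise. Let $\phi_{2M}=\phi_M(q_2)$, and let $\phi_Z(q)$ be the largest zero of $j(\cdot;q)$ in $[0,1]$. Analogously, with $u_{\rm infl}=2/(n_{RZ}+1)$, let $\varphi_M(q)$ be the local minimum point in $(u_{\rm infl},1]$ of $f_1(\cdot,0;q)$ on $[0,1]$ if $-q<-f_b'(u_{\rm infl})$, and $u_{\rm infl}$ otherwise; let $\varphi_{1m}\in[0,u_{\rm infl}]$ be the value with $f_1(\varphi_{1m},0;q_1)=f_1(\varphi_M(q_1),0;q_1)$. Let $\bar\phi_2$ be the smallest positive solution in $(0,1]$ of $s_F=j_2(\phi)$. Finally let $Z_{\rm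 fr}=Z_{\rm fr}(\phi_F,Q_F,Q_U,Q_W)$ be the height $z<z_E$ for which the problem $$\phi'=\frac{j_2(\phi)-s_F}{d(\phi)}\ \text{ on }(z,z_E),\qquad \phi(z)=\phi_c,\quad \phi(z_E)=\phi_E$$ has a strictly increasing solution continuous on $[z,z_E]$. A *desired steady state* is a stationary solution with admissible aggregate profile for which there are constants $p\in[0,\phi^M(q_2))$, $z_{\rm fr}\in(z_F,z_E)$, $e$, $\varphi_1\in[0,\varphi_{1m}]$, $\varphi_U$ and a function $\phi_{\rm par}$, continuous and strictly increasing on $[z_{\rm fr},z_E]$, differentiable on $(z_{\rm fr},z_E)$, with $\phi_{\rm par}(z_{\rm fr})=\phi_c$, $\phi_{\rm par}(z_E)=e$, such that $\phi=0$ for $z<z_U$ and for $z_U<z<z_F$ (no aggregates below the feed), $\phi=p$ on $(z_F,z_{\rm fr})$, $\phi=\phi_{\rm par}$ on $(z_{\rm fr},z_E)$ (a froth layer that does not fill zone 2), $\phi=e$ for $z>z_E$, and such that $\psi/(1-\phi)$ equals $0$ for $z>z_F$ (no solids above the feed), $\varphi_1$ on $(z_U,z_F)$ and $\varphi_U$ for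 $z<z_U$. **Theorem.** If a desired steady state exists, then the froth problem determines $Z_{\rm fr}$ (there is exactly one such height), and \begin{align*} &\text{(FIb)} && \bar\phi_2\le\phi_Z(-Q_U/A_U),\\ &\text{(FIas)} && A_U f_1\bigl(\varphi_M(-Q_U/A_U),0;-Q_U/A_U\bigr)\ge Q_F\psi_F,\\ &\text{(Froth1)} && Q_F\Bigl(1-\frac{\phi_F}{\phi_c}\Bigr)<Q_U-Q_W\le Q_F(1-\phi_F),\\ &\text{(Froth2)} && z_F<Z_{\rm fr}(\phi_F,Q_F,Q_U,Q_W),\\ &\text{(Froth3)} && s_F<j_2(\phi_{2M})\ \text{ if }\phi_{2M}<\phi_E,\qquad s_F\le j_2(\phi_E)\ \text{ if }\phi_{2M}\ge\phi_E. \end{align*} -/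

import Mathlib

open Set Filter Topology MeasureTheory

noncomputable section

namespace Flotation

/-- Geometry of the column and constants of the constitutive functions. -/
structure Column where
  /-- cross-sectional area above the feed level -/
  AE : ℝ
  /-- cross-sectional area below the feed level -/
  AU : ℝ
  /-- underflow level -/
  zU : ℝ
  /-- feed level -/
  zF : ℝ
  /-- effluent level -/
  zE : ℝ
  /-- critical volume fraction of aggregates, above which froth forms -/
  phic : ℝ
  /-- velocity of a single bubble -/
  vterm : ℝ
  /-- exponent of the bubble velocity below `phic` -/
  nb : ℝ
  /-- drainage exponent -/
  nS : ℝ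
  /-- capillarity-to-gravity parameter -/
  dcap : ℝ
  /-- settling velocity of a single solid particle -/
  vinf : ℝ
  /-- Richardson-Zaki exponent of the solids -/
  nRZ : ℝ
  AE_pos : 0 < AE
  AU_pos : 0 < AU
  zU_lt_zF : zU < zF
  zF_lt_zE : zF < zE
  phic_pos : 0 < phic
  phic_lt_one : phic < 1
  vterm_pos : 0 < vterm
  nS_pos : 0 < nS
  dcap_pos : 0 < dcap
  vinf_pos : 0 < vinf
  nRZ_gt_one : 1 < nRZ
  /-- the slope of the batch flux does not jump downwards at `phic` -/
  nb_ge : 1 + 2 * nS ≤ nb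
  /-- the inflection point of the high part of the batch flux lies below `phic` -/
  inflHigh_lt : 1 / (nS + 1) < phic

/-- Feed input variables and control variables (all constant in time). -/
structure Operation where
  QF : ℝ
  QU : ℝ
  QW : ℝ
  phiF : ℝ
  psiF : ℝ
  QF_pos : 0 < QF
  QU_nonneg : 0 ≤ QU
  QW_nonneg : 0 ≤ QW
  /-- the effluent volumetric flow is positive -/
  QE_pos : 0 < QW + QF - QU
  phiF_nonneg : 0 ≤ phiF
  psiF_nonneg : 0 ≤ psiF
  feed_le_one : phiF + psiF ≤ 1

/-! ### Constitutive functions -/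

/-- Drainage velocity, fixed by continuity of the bubble velocity at `phic`. -/
def vdrain (P : Column) : ℝ := P.vterm * (1 - P.phic) ^ (P.nb - 1 - 2 * P.nS)

/-- Velocity of the aggregates in a closed vessel. -/
def vtilde (P : Column) (φ : ℝ) : ℝ :=
  if φ ≤ P.phic then P.vterm * (1 - φ) ^ P.nb
  else vdrain P * (1 - φ) ^ (2 * P.nS + 1)

/-- Batch-drift flux of the aggregates. -/
def jb (P : Column) (φ : ℝ) : ℝ := φ * vtilde P φ

/-- Capillarity function. -/
def d (P : Column) (φ : ℝ) : ℝ :=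
  if φ ≤ P.phic then 0 else vdrain P * P.dcap * φ * (1 - φ) ^ P.nS

/-- Integrated capillarity function. -/
def D (P : Column) (φ : ℝ) : ℝ := ∫ s in (0 : ℝ)..φ, d P s

/-- Batch settling flux of the solids; the argument is the volume fraction of solids
within the suspension. -/
def fb (P : Column) (u : ℝ) : ℝ := u * (P.vinf * (1 - u) ^ P.nRZ)

/-! ### Zone flux functions -/

/-- Zone flux of the aggregates with bulk velocity `q`. -/
def j (P : Column) (q φ : ℝ) : ℝ := jb P φ + q * φ

/-- Zone-settling flux of the solids with bulk velocity `q`, positive downwards. -/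
def f (P : Column) (q u φ : ℝ) : ℝ := (1 - φ) * fb P u + (jb P φ - (1 - φ) * q) * u

/-- Bulk velocity in zone 1 and in the underflow zone. -/
def q1 (P : Column) (QU : ℝ) : ℝ := -QU / P.AU

/-- Bulk velocity in zone 2. -/
def q2 (P : Column) (QF QU : ℝ) : ℝ := (-QU + QF) / P.AE

/-- Bulk velocity in the effluent zone. -/
def qE (P : Column) (QF QU QW : ℝ) : ℝ := (-QU + QF + QW) / P.AE

/-- Cross-sectional area. -/
def area (P : Column) (z : ℝ) : ℝ := if P.zF ≤ z then P.AE else P.AU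

/-- Characteristic function of the interior of the tank. -/
def gam (P : Column) (z : ℝ) : ℝ := if P.zU ≤ z ∧ z < P.zE then 1 else 0

/-- Convective flux of the aggregates. -/
def J (P : Column) (O : Operation) (φ z : ℝ) : ℝ :=
  if P.zE ≤ z then qE P O.QF O.QU O.QW * φ
  else if P.zF ≤ z then j P (q2 P O.QF O.QU) φ
  else if P.zU ≤ z then j P (q1 P O.QU) φ
  else q1 P O.QU * φ

/-- Convective flux of the solids (positive downwards) as a function of the volume fraction `u`
of solids within the suspension. -/
def F (P : Column) (O : Operation) (u φ z : ℝ) : ℝ :=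
  if P.zE ≤ z then -(1 - φ) * qE P O.QF O.QU O.QW * u
  else if P.zF ≤ z then f P (q2 P O.QF O.QU) u φ
  else if P.zU ≤ z then f P (q1 P O.QU) u φ
  else -(1 - φ) * q1 P O.QU * u

/-- Convective flux of the solids as a function of the volume fraction `ψ` of solids. -/
def Ftilde (P : Column) (O : Operation) (ψ φ z : ℝ) : ℝ :=
  if φ < 1 then F P O (ψ / (1 - φ)) φ z else 0

/-! ### Stationary solutions of the governing system -/

/-- `w` is the weak derivative of `D(φ)` in the interior of the tank. -/
def IsWeakDerivD (P : Column) (φ w : ℝ → ℝ) : Prop :=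
  IntegrableOn w (Ioo P.zU P.zE) ∧
  ∀ η : ℝ → ℝ, ContDiff ℝ (⊤ : ℕ∞) η → HasCompactSupport η → tsupport η ⊆ Ioo P.zU P.zE →
    ∫ z in Ioo P.zU P.zE, D P (φ z) * deriv η z = -∫ z in Ioo P.zU P.zE, w z * η z

/-- Stationary weak solution `(φ, ψ)` on the real line of
`A ∂ₜ(φ, ψ) + ∂_z (A (J, -Ftilde)) = ∂_z (A γ ∂_z D(φ) (1, -ψ / (1 - φ))) + Q_F (φ_F, ψ_F) δ_{z_F}`,
where `φ` and `ψ` are volume fractions. -/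
def IsStationarySolution (P : Column) (O : Operation) (φ ψ : ℝ → ℝ) : Prop :=
  Measurable φ ∧ Measurable ψ ∧
  (∀ z, 0 ≤ φ z ∧ 0 ≤ ψ z ∧ φ z + ψ z ≤ 1) ∧
  ∃ w : ℝ → ℝ, IsWeakDerivD P φ w ∧
    ∀ η : ℝ → ℝ, ContDiff ℝ (⊤ : ℕ∞) η → HasCompactSupport η →
      (∫ z, area P z * (J P O (φ z) z - gam P z * w z) * deriv η z
        = -(O.QF * O.phiF * η P.zF)) ∧
      (∫ z, area P z *
          (-Ftilde P O (ψ z) (φ z) z + gam P z * (ψ z / (1 - φ z)) * w z) * deriv η z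
        = -(O.QF * O.psiF * η P.zF))

/-- Convective mass flux of the aggregates minus the mass flux fed below height `z`. -/
def G (P : Column) (O : Operation) (v z : ℝ) : ℝ :=
  area P z * J P O v z - (if P.zF ≤ z then O.QF * O.phiF else 0)

/-- Entropy condition for a stationary discontinuity from `uL` (left) to `uR` (right) inside a
zone with flux function `g` and constant total flux `c`: the graph of `g` lies above `c` between
the two values if the jump is upwards, and below `c` if it is downwards. -/
def ShockAdmissible (g : ℝ → ℝ) (c uL uR : ℝ) : Prop :=
  (uL < uR → ∀ v ∈ Ioo uL uR, c < g v) ∧ (uR < uL → ∀ v ∈ Ioo uR uL, g v < c)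

/-- Uniqueness condition for a stationary discontinuity from `uL` to `uR` at a height where the
flux function changes from `gL` to `gR` (sources included), with constant total flux `c`: the two
values are the end states of a monotone viscous profile through an intermediate value `u₀`. -/
def InterfaceAdmissible (gL gR : ℝ → ℝ) (c uL uR : ℝ) : Prop :=
  (uL < uR → ∃ u₀ ∈ Icc uL uR, (∀ v ∈ Icc uL u₀, c ≤ gL v) ∧ ∀ v ∈ Icc u₀ uR, c ≤ gR v) ∧
  (uR < uL → ∃ u₀ ∈ Icc uR uL, (∀ v ∈ Icc u₀ uL, gL v ≤ c) ∧ ∀ v ∈ Icc uR u₀, gR v ≤ c)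

/-- All discontinuities of the stationary aggregate profile `φ` are admissible. The constant mass
flux is `-Q_U φ_U`, where `φ_U` is the underflow concentration. -/
def HasAdmissibleJumps (P : Column) (O : Operation) (φ : ℝ → ℝ) : Prop :=
  ∃ φU, Tendsto φ (𝓝[<] P.zU) (𝓝 φU) ∧
    ∀ z₀ uL uR, Tendsto φ (𝓝[<] z₀) (𝓝 uL) → Tendsto φ (𝓝[>] z₀) (𝓝 uR) →
      (z₀ ≠ P.zU ∧ z₀ ≠ P.zF ∧ z₀ ≠ P.zE →
        ShockAdmissible (fun v => G P O v z₀) (-O.QU * φU) uL uR) ∧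
      (z₀ = P.zU ∨ z₀ = P.zF ∨ z₀ = P.zE →
        InterfaceAdmissible (fun v => Function.leftLim (G P O v) z₀)
          (fun v => Function.rightLim (G P O v) z₀) (-O.QU * φU) uL uR)

/-! ### Characteristic points of the zone flux functions -/

/-- Inflection point of the batch flux of the aggregates. -/
def inflj (P : Column) : ℝ := 2 / (P.nb + 1)

/-- Local maximum point `φ^M(q)` of `j(·; q)`. -/
def phiMax (P : Column) (q : ℝ) : ℝ :=
  if q ≤ -deriv (jb P) 0 then 0
  else if q < -deriv (jb P) (inflj P) then
    Function.invFunOn (deriv (jb P)) (Ioo 0 (inflj P)) (-q)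
  else inflj P

/-- Local minimum point `φ_M(q)` of `j(·; q)` on `[0, 1]`, greater than the inflection point;
the inflection point itself if `j(·; q)` is increasing. -/
def phiMin (P : Column) (q : ℝ) : ℝ :=
  if -deriv (jb P) (inflj P) ≤ q then inflj P
  else sInf {x | x ∈ Ioc (inflj P) 1 ∧ IsLocalMinOn (j P q) (Icc 0 1) x}

/-- Largest zero `φ_Z(q)` of `j(·; q)` in `[0, 1]`. -/
def phiZ (P : Column) (q : ℝ) : ℝ := sSup {x | x ∈ Icc (0 : ℝ) 1 ∧ j P q x = 0}

/-- Inflection point of the batch flux of the solids. -/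
def inflf (P : Column) : ℝ := 2 / (P.nRZ + 1)

/-- Local minimum point of `f(·, 0; q)` on `[0, 1]`, greater than the inflection point; the
inflection point itself if `f(·, 0; q)` is increasing. -/
def varphiMin (P : Column) (q : ℝ) : ℝ :=
  if -deriv (fb P) (inflf P) ≤ -q then inflf P
  else sInf {x | x ∈ Ioc (inflf P) 1 ∧ IsLocalMinOn (fun u => f P q u 0) (Icc 0 1) x}

/-- The value not above the inflection point at which `f(·, 0; q)` equals its value at the local
minimum point. -/
def varphim (P : Column) (q : ℝ) : ℝ :=
  sInf {x | x ∈ Icc 0 (inflf P) ∧ f P q x 0 = f P q (varphiMin P q) 0}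

/-! ### Quantities determined by the feed and control variables -/

/-- Feed mass flux of aggregates per unit area. -/
def sF (P : Column) (phiF QF : ℝ) : ℝ := QF * phiF / P.AE

/-- Effluent concentration of aggregates. -/
def phiE (phiF QF QU QW : ℝ) : ℝ := QF * phiF / (QW + QF - QU)

/-- Smallest positive solution of the jump condition `s_F = j₂(φ; q₂)` at the feed level. -/
def phiBar2 (P : Column) (phiF QF QU : ℝ) : ℝ :=
  sInf {x | x ∈ Ioc (0 : ℝ) 1 ∧ sF P phiF QF = j P (q2 P QF QU) x}

/-- `z` is the lower end of the interval on which the froth boundary-value problem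
`φ' = (j₂(φ; q₂) - s_F) / d(φ)`, `φ(z) = φ_c`, `φ(z_E) = φ_E` has a strictly increasing solution. -/
def IsFrothInterface (P : Column) (phiF QF QU QW z : ℝ) : Prop :=
  z < P.zE ∧ ∃ φ : ℝ → ℝ, ContinuousOn φ (Icc z P.zE) ∧ StrictMonoOn φ (Icc z P.zE) ∧
    (∀ x ∈ Ioo z P.zE,
      HasDerivAt φ ((j P (q2 P QF QU) (φ x) - sF P phiF QF) / d P (φ x)) x) ∧
    φ z = P.phic ∧ φ P.zE = phiE phiF QF QU QW

open Classical in
/-- Location `Z_fr` of the froth interface defined by the froth boundary-value problem. -/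
def Zfr (P : Column) (phiF QF QU QW : ℝ) : ℝ :=
  if h : ∃ z, IsFrothInterface P phiF QF QU QW z then h.choose else 0

/-! ### Desired steady states -/

/-- `(φ, ψ)` is a desired steady state: an admissible stationary solution without aggregates below
the feed level and without solids above it, whose aggregate volume fraction in zone 2 is a
constant `p < φ^M(q₂)` below a height `zfr` inside the zone and above it a continuous froth layer
increasing strictly from `φ_c` to the effluent concentration `e`; the solids
have a constant volume fraction `u₁ ∈ [0, φ_m]` within the suspension in zone 1. -/
def IsDesiredSteadyState (P : Column) (O : Operation) (φ ψ : ℝ → ℝ) : Prop :=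
  IsStationarySolution P O φ ψ ∧ HasAdmissibleJumps P O φ ∧
  ∃ (p zfr e u₁ uU : ℝ) (φpar : ℝ → ℝ),
    -- the aggregates
    0 ≤ p ∧ p < phiMax P (q2 P O.QF O.QU) ∧
    P.zF < zfr ∧ zfr < P.zE ∧
    ContinuousOn φpar (Icc zfr P.zE) ∧ StrictMonoOn φpar (Icc zfr P.zE) ∧
    DifferentiableOn ℝ φpar (Ioo zfr P.zE) ∧
    φpar zfr = P.phic ∧ φpar P.zE = e ∧
    (∀ z < P.zU, φ z = 0) ∧
    (∀ z ∈ Ioo P.zU P.zF, φ z = 0) ∧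
    (∀ z ∈ Ioo P.zF zfr, φ z = p) ∧
    (∀ z ∈ Ioo zfr P.zE, φ z = φpar z) ∧
    (∀ z > P.zE, φ z = e) ∧
    -- the solids, through their volume fraction within the suspension
    u₁ ∈ Icc 0 (varphim P (q1 P O.QU)) ∧
    (∀ z > P.zF, ψ z / (1 - φ z) = 0) ∧
    (∀ z ∈ Ioo P.zU P.zF, ψ z / (1 - φ z) = u₁) ∧
    (∀ z < P.zU, ψ z / (1 - φ z) = uU)

end Flotation

end

/-!
The weak equations are first turned into first integrals. The total aggregate flux, minus the feed
below the current height, has zero distributional derivative and vanishes below `zU`, hence vanishes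
almost everywhere (`ae_total_flux`). Read zone by zone this says: in zone 1 there is no capillary
flux; in the constant part of zone 2 the convective flux balances the feed, `j₂(p) = s_F`; above
`zE` the concentration is `φ_E`; and on the froth layer the profile satisfies the froth equation,
first almost everywhere and then, by the fundamental theorem of calculus, everywhere
(`isFrothProfile_of_weak`). For the solids, testing with a bump function at the feed level gives
`A_U f₁(u₁, 0; q₁) = Q_F ψ_F` (`solids_flux_zone_one`).

(FIas) holds since the flux cannot exceed its value at the local minimum point before `varphim`
(`f_le_of_mem_varphim`). For (FIb), `j₂` is strictly increasing up to `phiMax`, so the interface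
condition at the feed level leaves only the intermediate value `p`; thus `j₁(p) ≥ 0`, and `j₁` has
a zero in `[p, 1]` because `j₁(1) = q₁ ≤ 0` (`le_phiZ_of_interfaceAdmissible`). Here `p > 0`, as
otherwise `s_F = 0` and `φ_E = 0 < φ_c`. (Froth1) is `φ_c < φ_E ≤ 1`.

A strictly increasing solution of the froth equation has `j₂ ≥ s_F` along it, and equality at a
value in `[φ_c, φ_E)` would trap the solution there by a Gronwall argument
(`false_of_leave_equilibrium`); hence `j₂ > s_F` on `[φ_c, φ_E)` (`IsFrothProfile.lt_flux`).
Separation of variables then shows that all solutions need the same height to grow from `φ_c` to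
`φ_E` (`start_unique`), which gives (Froth2). For (Froth3), the point `φ_M(q₂)` is at least the
inflection point and so exceeds `p`; between `p` and `φ_c` the admissibility of the jump at the
froth interface gives `s_F < j₂`, and from `φ_c` on the froth solution does.
-/

noncomputable section

namespace Flotation

/-! ### Shape of the aggregate flux -/

theorem vdrain_pos (P : Column) : 0 < vdrain P :=
  mul_pos P.vterm_pos (Real.rpow_pos_of_pos (by linarith [P.phic_lt_one]) _)

theorem jb_of_le (P : Column) {x : ℝ} (hx : x ≤ P.phic) :
    jb P x = x * (P.vterm * (1 - x) ^ P.nb) := by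
  simp [jb, vtilde, hx]

theorem jb_of_ge (P : Column) {x : ℝ} (hx : P.phic ≤ x) :
    jb P x = x * (vdrain P * (1 - x) ^ (2 * P.nS + 1)) := by
  rcases hx.eq_or_lt with rfl | h
  · have h1 : 0 < 1 - P.phic := by linarith [P.phic_lt_one]
    rw [jb_of_le P le_rfl, vdrain, mul_assoc P.vterm, ← Real.rpow_add h1]
    congr 4
    ring
  · simp [jb, vtilde, not_le.mpr h]

theorem continuous_jb (P : Column) : Continuous (jb P) := by
  have hn : 0 ≤ P.nb := by linarith [P.nb_ge, P.nS_pos]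
  have hS : 0 ≤ 2 * P.nS + 1 := by linarith [P.nS_pos]
  have h : jb P = fun x => if x ≤ P.phic then x * (P.vterm * (1 - x) ^ P.nb)
      else x * (vdrain P * (1 - x) ^ (2 * P.nS + 1)) := by
    funext x
    simp only [jb, vtilde]
    split_ifs <;> rfl
  rw [h]
  refine Continuous.if_le ?_ ?_ continuous_id continuous_const ?_
  · exact continuous_id.mul (continuous_const.mul
      ((continuous_const.sub continuous_id).rpow_const fun _ => Or.inr hn))
  · exact continuous_id.mul (continuous_const.mul
      ((continuous_const.sub continuous_id).rpow_const fun _ => Or.inr hS))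
  · intro x hx
    rw [← jb_of_le P hx.le, ← jb_of_ge P hx.ge]

theorem continuous_j (P : Column) (q : ℝ) : Continuous (j P q) :=
  (continuous_jb P).add (continuous_const.mul continuous_id)

theorem j_zero (P : Column) (q : ℝ) : j P q 0 = 0 := by simp [j, jb]

theorem j_one (P : Column) (q : ℝ) : j P q 1 = q := by
  have hS : 2 * P.nS + 1 ≠ 0 := by linarith [P.nS_pos]
  simp [j, jb_of_ge P P.phic_lt_one.le, Real.zero_rpow hS]

theorem inflj_pos (P : Column) : 0 < inflj P :=
  div_pos two_pos (by linarith [P.nb_ge, P.nS_pos])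

theorem inflj_lt_phic (P : Column) : inflj P < P.phic := by
  refine lt_of_le_of_lt ?_ P.inflHigh_lt
  have := P.nb_ge
  have := P.nS_pos
  rw [inflj, div_le_div_iff₀ (by linarith) (by linarith)]
  linarith

/-- Derivative of the batch flux of the aggregates on the part below `phic`. -/
def jbSlope (P : Column) (x : ℝ) : ℝ :=
  P.vterm * ((1 - x) ^ (P.nb - 1) * (1 - (P.nb + 1) * x))

theorem hasDerivAt_jb (P : Column) {x : ℝ} (hx : x < P.phic) :
    HasDerivAt (jb P) (jbSlope P x) x := by
  have h1 : 0 < 1 - x := by linarith [P.phic_lt_one]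
  have h2 : HasDerivAt (fun y : ℝ => 1 - y) (-1) x := by
    simpa using (hasDerivAt_id x).const_sub 1
  have h3 := (hasDerivAt_id x).mul ((h2.rpow_const (p := P.nb) (Or.inl h1.ne')).const_mul P.vterm)
  have h4 : jb P =ᶠ[𝓝 x] (id * fun y => P.vterm * (1 - y) ^ P.nb) := by
    filter_upwards [Iio_mem_nhds hx] with y hy
    exact jb_of_le P (le_of_lt hy)
  refine (h3.congr_of_eventuallyEq h4).congr_deriv ?_
  have h5 : (1 - x) ^ P.nb = (1 - x) ^ (P.nb - 1) * (1 - x) := by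
    rw [← Real.rpow_add_one h1.ne']
    congr 1
    ring
  simp only [jbSlope, id, h5]
  ring

theorem deriv_jb (P : Column) {x : ℝ} (hx : x < P.phic) : deriv (jb P) x = jbSlope P x :=
  (hasDerivAt_jb P hx).deriv

theorem continuousOn_jbSlope (P : Column) : ContinuousOn (jbSlope P) (Iic P.phic) := by
  unfold jbSlope
  refine continuousOn_const.mul (ContinuousOn.mul ?_ (by fun_prop))
  refine ContinuousOn.rpow_const (by fun_prop) fun x hx => Or.inl ?_
  have : x ≤ P.phic := hx
  linarith [P.phic_lt_one]

/-- The batch flux is strictly concave up to its inflection point. -/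
theorem strictAntiOn_jbSlope (P : Column) : StrictAntiOn (jbSlope P) (Icc 0 (inflj P)) := by
  have hI := inflj_lt_phic P
  refine strictAntiOn_of_deriv_neg (convex_Icc _ _)
    ((continuousOn_jbSlope P).mono fun x hx => hx.2.trans hI.le) fun x hx => ?_
  rw [interior_Icc] at hx
  have hn : 1 < P.nb := by linarith [P.nb_ge, P.nS_pos]
  have h1 : 0 < 1 - x := by linarith [P.phic_lt_one, hx.2]
  have h2 : HasDerivAt (fun y : ℝ => 1 - y) (-1) x := by
    simpa using (hasDerivAt_id x).const_sub 1
  have h3 : HasDerivAt (fun y : ℝ => 1 - (P.nb + 1) * y) (-(P.nb + 1)) x := by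
    simpa using ((hasDerivAt_id x).const_mul (P.nb + 1)).const_sub 1
  have h4 := ((h2.rpow_const (p := P.nb - 1) (Or.inl h1.ne')).mul h3).const_mul P.vterm
  have h5 : (1 - x) ^ (P.nb - 1) = (1 - x) ^ (P.nb - 1 - 1) * (1 - x) := by
    rw [← Real.rpow_add_one h1.ne']
    congr 1
    ring
  have h6 : (P.nb + 1) * x < 2 := by
    have := hx.2
    rw [inflj, lt_div_iff₀ (by linarith)] at this
    linarith
  have h7 : deriv (jbSlope P) x
      = -(P.vterm * (1 - x) ^ (P.nb - 1 - 1) * (P.nb * (2 - (P.nb + 1) * x))) := by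
    refine h4.deriv.trans ?_
    rw [h5]
    ring
  rw [h7, neg_lt_zero]
  have := P.vterm_pos
  have := Real.rpow_pos_of_pos h1 (P.nb - 1 - 1)
  have : 0 < 2 - (P.nb + 1) * x := by linarith
  positivity

theorem phiMax_le_and_slope (P : Column) (q : ℝ) :
    phiMax P q ≤ inflj P ∧ ∀ x ∈ Ico 0 (phiMax P q), 0 < jbSlope P x + q := by
  have hI := inflj_lt_phic P
  have hI0 := inflj_pos P
  have hanti := strictAntiOn_jbSlope P
  unfold phiMax
  rw [deriv_jb P P.phic_pos, deriv_jb P hI]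
  split_ifs with h1 h2
  · exact ⟨hI0.le, fun x hx => by simp at hx⟩
  · -- the intermediate value theorem makes the value of `invFunOn` meaningful
    have hmem : -q ∈ deriv (jb P) '' Ioo 0 (inflj P) := by
      have hcont : ContinuousOn (jbSlope P) (Icc 0 (inflj P)) :=
        (continuousOn_jbSlope P).mono fun x hx => hx.2.trans hI.le
      obtain ⟨x, hx, hxq⟩ := intermediate_value_Ioo' hI0.le hcont
        (show -q ∈ Ioo _ _ from ⟨by linarith, by linarith⟩)
      exact ⟨x, hx, (deriv_jb P (hx.2.trans hI)).trans hxq⟩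
    have hm := Function.invFunOn_mem hmem
    have he := Function.invFunOn_eq hmem
    rw [deriv_jb P (hm.2.trans hI)] at he
    refine ⟨hm.2.le, fun x hx => ?_⟩
    have := hanti ⟨hx.1, (hx.2.trans hm.2).le⟩ ⟨hm.1.le, hm.2.le⟩ hx.2
    linarith
  · refine ⟨le_rfl, fun x hx => ?_⟩
    have := hanti ⟨hx.1, hx.2.le⟩ ⟨hI0.le, le_rfl⟩ hx.2
    linarith

theorem phiMax_le (P : Column) (q : ℝ) : phiMax P q ≤ inflj P := (phiMax_le_and_slope P q).1

theorem strictMonoOn_j (P : Column) (q : ℝ) : StrictMonoOn (j P q) (Icc 0 (phiMax P q)) := by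
  refine strictMonoOn_of_deriv_pos (convex_Icc _ _) (continuous_j P q).continuousOn fun x hx => ?_
  rw [interior_Icc] at hx
  have hx' : x < P.phic := hx.2.trans_le ((phiMax_le P q).trans (inflj_lt_phic P).le)
  have h := (hasDerivAt_jb P hx').add ((hasDerivAt_id x).const_mul q)
  have h2 : deriv (j P q) x = jbSlope P x + q * 1 := h.deriv
  rw [h2, mul_one]
  exact (phiMax_le_and_slope P q).2 x ⟨hx.1.le, hx.2⟩

/-- The local minimum point lies above the inflection point. The content is that, when
`j(·; q)` decreases at the inflection point, a local minimum exists beyond it, so that the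
infimum in `phiMin` is not that of the empty set. -/
theorem inflj_le_phiMin (P : Column) (q : ℝ) : inflj P ≤ phiMin P q := by
  have hI := inflj_lt_phic P
  have hI0 := inflj_pos P
  unfold phiMin
  split_ifs with h
  · exact le_rfl
  rw [deriv_jb P hI] at h
  refine le_csInf ?_ fun x hx => hx.1.1.le
  have hI1 : inflj P ≤ 1 := (hI.trans P.phic_lt_one).le
  obtain ⟨x, hx, hmin⟩ := isCompact_Icc.exists_isMinOn (nonempty_Icc.2 hI1)
    (continuous_j P q).continuousOn
  have hne : inflj P ≠ x := by
    rintro rfl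
    have hd : HasDerivAt (j P q) (jbSlope P (inflj P) + q * 1) (inflj P) :=
      (hasDerivAt_jb P hI).add ((hasDerivAt_id _).const_mul q)
    have hneg : jbSlope P (inflj P) + q * 1 < 0 := by linarith
    have hs : ∀ᶠ y in 𝓝[>] inflj P, slope (j P q) (inflj P) y < 0 :=
      ((hasDerivAt_iff_tendsto_slope.1 hd).mono_left
        (nhdsWithin_mono _ fun y hy => ne_of_gt hy)).eventually (Iio_mem_nhds hneg)
    have hr : ∀ᶠ y in 𝓝[>] inflj P, y ∈ Ioc (inflj P) 1 :=
      Ioc_mem_nhdsGT (hI.trans P.phic_lt_one)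
    obtain ⟨y, hy1, hy2⟩ := (hs.and hr).exists
    have h3 : j P q (inflj P) ≤ j P q y := hmin ⟨hy2.1.le, hy2.2⟩
    rw [slope_def_field] at hy1
    have h4 : 0 ≤ (j P q y - j P q (inflj P)) / (y - inflj P) :=
      div_nonneg (by linarith) (by linarith [hy2.1])
    linarith
  have hlt : inflj P < x := lt_of_le_of_ne hx.1 hne
  refine ⟨x, ⟨hlt, hx.2⟩, ?_⟩
  filter_upwards [mem_nhdsWithin_of_mem_nhds (Ioi_mem_nhds hlt), self_mem_nhdsWithin] with y hy hy1
  exact hmin ⟨le_of_lt hy, hy1.2⟩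

/-! ### The integrated capillarity -/

/-- The expression of the capillarity function above `phic`. -/
def dHigh (P : Column) (x : ℝ) : ℝ := vdrain P * P.dcap * x * (1 - x) ^ P.nS

theorem continuous_dHigh (P : Column) : Continuous (dHigh P) :=
  (continuous_const.mul continuous_id).mul
    ((continuous_const.sub continuous_id).rpow_const fun _ => Or.inr P.nS_pos.le)

theorem dHigh_pos (P : Column) {x : ℝ} (h0 : 0 < x) (h1 : x < 1) : 0 < dHigh P x := by
  have := Real.rpow_pos_of_pos (sub_pos.2 h1) P.nS
  have := vdrain_pos P
  have := P.dcap_pos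
  unfold dHigh
  positivity

theorem d_eq_indicator (P : Column) : d P = (Ioi P.phic).indicator (dHigh P) := by
  funext x
  by_cases h : x ≤ P.phic
  · simp [d, h]
  · simp [d, h, dHigh, not_le.1 h]

theorem d_of_gt (P : Column) {x : ℝ} (hx : P.phic < x) : d P x = dHigh P x := by
  rw [d_eq_indicator, indicator_of_mem (show x ∈ Ioi P.phic from hx)]

theorem intervalIntegrable_d (P : Column) (a b : ℝ) : IntervalIntegrable (d P) volume a b := by
  rw [d_eq_indicator, intervalIntegrable_iff]
  exact (intervalIntegrable_iff.1 ((continuous_dHigh P).intervalIntegrable a b)).indicator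
    measurableSet_Ioi

theorem continuous_D (P : Column) : Continuous (D P) :=
  intervalIntegral.continuous_primitive (intervalIntegrable_d P) 0

theorem hasDerivAt_D (P : Column) {x : ℝ} (hx : P.phic < x) : HasDerivAt (D P) (d P x) x := by
  refine intervalIntegral.integral_hasDerivAt_right (intervalIntegrable_d P 0 x) ?_ ?_
  · rw [d_eq_indicator]
    exact ((continuous_dHigh P).stronglyMeasurable.indicator
      measurableSet_Ioi).stronglyMeasurableAtFilter
  · refine (continuous_dHigh P).continuousAt.congr ?_
    filter_upwards [Ioi_mem_nhds hx] with y hy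
    exact (d_of_gt P hy).symm

/-! ### Weak formulation -/

/-- A primitive of a test function that vanishes to the right, cut off to the left of `a`, is a
test function whose derivative agrees with the given one to the right of `a`. -/
theorem exists_cutoff_primitive {g : ℝ → ℝ} (hg : ContDiff ℝ (⊤ : ℕ∞) g)
    (hc : HasCompactSupport g) (a : ℝ) :
    ∃ η : ℝ → ℝ, ContDiff ℝ (⊤ : ℕ∞) η ∧ HasCompactSupport η ∧ ∀ x > a, deriv η x = g x := by
  obtain ⟨b, hb⟩ : ∃ b, ∀ x ≥ b, g x = 0 := by
    obtain ⟨b, hb⟩ := hc.isCompact.isBounded.bddAbove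
    refine ⟨b + 1, fun x hx => image_eq_zero_of_notMem_tsupport fun h => ?_⟩
    have := hb h
    linarith
  set K : ℝ → ℝ := fun x => ∫ t in b..x, g t with hK
  have hKd : ∀ x, HasDerivAt K (g x) x := fun x => hg.continuous.integral_hasStrictDerivAt b x
    |>.hasDerivAt
  have hKs : ContDiff ℝ (⊤ : ℕ∞) K := by
    rw [contDiff_infty_iff_deriv]
    refine ⟨fun x => (hKd x).differentiableAt, ?_⟩
    rw [show deriv K = g from funext fun x => (hKd x).deriv]
    exact hg
  have hK0 : ∀ x ≥ b, K x = 0 := fun x hx => by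
    simp only [hK]
    rw [intervalIntegral.integral_congr (g := fun _ => 0)]
    · simp
    · intro t ht
      rw [uIcc_of_le hx] at ht
      exact hb t ht.1
  have hχ : ContDiff ℝ (⊤ : ℕ∞) fun x : ℝ => Real.smoothTransition (x - (a - 1)) :=
    Real.smoothTransition.contDiff.comp (contDiff_id.sub contDiff_const)
  refine ⟨fun x => Real.smoothTransition (x - (a - 1)) * K x, hχ.mul hKs, ?_, fun x hx => ?_⟩
  · refine HasCompactSupport.intro (isCompact_Icc (a := a - 1) (b := b)) fun x hx => ?_
    rcases le_or_gt (a - 1) x with h | h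
    · rw [hK0 x (le_of_not_ge fun h' => hx ⟨h, h'⟩), mul_zero]
    · rw [Real.smoothTransition.zero_of_nonpos (by linarith), zero_mul]
  · have : (fun x => Real.smoothTransition (x - (a - 1)) * K x) =ᶠ[𝓝 x] K := by
      filter_upwards [Ioi_mem_nhds hx] with y hy
      have : a < y := hy
      rw [Real.smoothTransition.one_of_one_le (by linarith), one_mul]
    rw [this.deriv_eq, (hKd x).deriv]

/-- A function with vanishing distributional derivative that vanishes on a half-line vanishes
almost everywhere. -/
theorem ae_eq_zero_of_integral_mul_deriv {N : ℝ → ℝ} {a : ℝ} (hN : LocallyIntegrable N)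
    (ha : ∀ x < a, N x = 0)
    (h : ∀ η : ℝ → ℝ, ContDiff ℝ (⊤ : ℕ∞) η → HasCompactSupport η → ∫ x, N x * deriv η x = 0) :
    ∀ᵐ x, N x = 0 := by
  refine ae_eq_zero_of_integral_contDiff_smul_eq_zero hN fun g hg hc => ?_
  obtain ⟨η, h1, h2, h3⟩ := exists_cutoff_primitive hg hc a
  rw [← h η h1 h2]
  refine integral_congr_ae ?_
  filter_upwards [Measure.ae_ne volume a] with x hx
  rcases lt_or_gt_of_ne hx with hlt | hgt
  · simp [ha x hlt]
  · rw [h3 x hgt, smul_eq_mul, mul_comm]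

theorem integral_step_mul_deriv {η : ℝ → ℝ} (hη : ContDiff ℝ (⊤ : ℕ∞) η)
    (hc : HasCompactSupport η) (a m : ℝ) :
    ∫ x, (if a ≤ x then m else 0) * deriv η x = -(m * η a) := by
  have h1 : ∀ x, (if a ≤ x then m else 0) * deriv η x
      = (Ici a).indicator (fun x => m * deriv η x) x := fun x => by
    by_cases h : a ≤ x <;> simp [h]
  simp_rw [h1]
  rw [integral_indicator measurableSet_Ici, integral_Ici_eq_integral_Ioi, integral_const_mul,
    hc.integral_Ioi_deriv_eq (hη.of_le (by exact_mod_cast le_top))]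
  ring

theorem measurable_area (P : Column) : Measurable (area P) :=
  Measurable.ite measurableSet_Ici measurable_const measurable_const

theorem measurable_J (P : Column) (O : Operation) {φ : ℝ → ℝ} (hφ : Measurable φ) :
    Measurable fun z => J P O (φ z) z := by
  unfold J
  refine Measurable.ite measurableSet_Ici (hφ.const_mul _) ?_
  refine Measurable.ite measurableSet_Ici ((continuous_j P _).measurable.comp hφ) ?_
  exact Measurable.ite measurableSet_Ici ((continuous_j P _).measurable.comp hφ) (hφ.const_mul _)

theorem exists_bound_J (P : Column) (O : Operation) :
    ∃ C, ∀ v ∈ Icc (0 : ℝ) 1, ∀ z, ‖J P O v z‖ ≤ C := by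
  have key : ∀ g : ℝ → ℝ, Continuous g → ∃ C, ∀ v ∈ Icc (0 : ℝ) 1, ‖g v‖ ≤ C := fun g hg =>
    isCompact_Icc.exists_bound_of_continuousOn hg.continuousOn
  obtain ⟨C1, h1⟩ := key (fun v => qE P O.QF O.QU O.QW * v) (by fun_prop)
  obtain ⟨C2, h2⟩ := key _ (continuous_j P (q2 P O.QF O.QU))
  obtain ⟨C3, h3⟩ := key _ (continuous_j P (q1 P O.QU))
  obtain ⟨C4, h4⟩ := key (fun v => q1 P O.QU * v) (by fun_prop)
  refine ⟨max (max C1 C2) (max C3 C4), fun v hv z => ?_⟩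
  unfold J
  split_ifs
  · exact (h1 v hv).trans (by simp)
  · exact (h2 v hv).trans (by simp)
  · exact (h3 v hv).trans (by simp)
  · exact (h4 v hv).trans (by simp)

theorem locallyIntegrable_of_bound {f : ℝ → ℝ} (hf : Measurable f) {C : ℝ}
    (hC : ∀ x, ‖f x‖ ≤ C) : LocallyIntegrable f :=
  (locallyIntegrable_const C).mono hf.aestronglyMeasurable
    (Eventually.of_forall fun x => (hC x).trans (le_abs_self C))

theorem integrable_gam_mul (P : Column) {w : ℝ → ℝ} (hw : IntegrableOn w (Ioo P.zU P.zE)) :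
    Integrable fun z => gam P z * w z := by
  have : (fun z => gam P z * w z) = (Ico P.zU P.zE).indicator w := by
    funext z
    by_cases h : P.zU ≤ z ∧ z < P.zE
    · rw [indicator_of_mem (show z ∈ Ico P.zU P.zE from h)]
      simp [gam, h]
    · rw [indicator_of_notMem (show z ∉ Ico P.zU P.zE from h)]
      simp [gam, h]
  rw [this, integrable_indicator_iff measurableSet_Ico]
  exact hw.congr_set_ae Ioo_ae_eq_Ico.symm

/-- First integral of the aggregate equation when no aggregates leave through the underflow: the
total mass flux vanishes below the feed level and equals the feed flux above it. -/
theorem ae_total_flux (P : Column) (O : Operation) {φ w : ℝ → ℝ} (hφ : Measurable φ)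
    (hb : ∀ z, φ z ∈ Icc (0 : ℝ) 1) (hw : IntegrableOn w (Ioo P.zU P.zE))
    (h0 : ∀ z < P.zU, φ z = 0)
    (h : ∀ η : ℝ → ℝ, ContDiff ℝ (⊤ : ℕ∞) η → HasCompactSupport η →
      ∫ z, area P z * (J P O (φ z) z - gam P z * w z) * deriv η z = -(O.QF * O.phiF * η P.zF)) :
    ∀ᵐ z, area P z * (J P O (φ z) z - gam P z * w z)
      = if P.zF ≤ z then O.QF * O.phiF else 0 := by
  obtain ⟨C, hC⟩ := exists_bound_J P O
  have hA : ∀ z, ‖area P z‖ ≤ max P.AE P.AU := fun z => by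
    unfold area
    split_ifs
    · rw [Real.norm_of_nonneg P.AE_pos.le]; exact le_max_left _ _
    · rw [Real.norm_of_nonneg P.AU_pos.le]; exact le_max_right _ _
  have hM : LocallyIntegrable fun z => area P z * (J P O (φ z) z - gam P z * w z) := by
    have h1 : LocallyIntegrable fun z => area P z * J P O (φ z) z := by
      refine locallyIntegrable_of_bound (C := max P.AE P.AU * C)
        ((measurable_area P).mul (measurable_J P O hφ)) fun z => ?_
      rw [norm_mul]
      exact mul_le_mul (hA z) (hC _ (hb z) z) (norm_nonneg _) ((norm_nonneg _).trans (hA z))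
    have h2 : Integrable fun z => area P z * (gam P z * w z) :=
      (integrable_gam_mul P hw).bdd_mul (measurable_area P).aestronglyMeasurable
        (Eventually.of_forall hA)
    simp_rw [mul_sub]
    exact h1.sub h2.locallyIntegrable
  have hS : LocallyIntegrable fun z => if P.zF ≤ z then O.QF * O.phiF else 0 := by
    refine locallyIntegrable_of_bound (C := |O.QF * O.phiF|)
      (Measurable.ite measurableSet_Ici measurable_const measurable_const) fun z => ?_
    split_ifs
    · exact le_rfl
    · rw [norm_zero]; exact abs_nonneg _
  have hzero := ae_eq_zero_of_integral_mul_deriv (a := P.zU) (hM.sub hS) (fun z hz => ?_)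
    fun η hη hc => ?_
  · filter_upwards [hzero] with z hz
    exact sub_eq_zero.1 hz
  · have hF := hz.trans P.zU_lt_zF
    have hE := hF.trans P.zF_lt_zE
    simp [J, gam, h0 z hz, not_le.2 hz, not_le.2 hF, not_le.2 hE]
  · have hcd : Continuous (deriv η) := hη.continuous_deriv (by exact_mod_cast le_top)
    have i1 := hM.integrable_smul_right_of_hasCompactSupport hcd hc.deriv
    have i2 := hS.integrable_smul_right_of_hasCompactSupport hcd hc.deriv
    simp only [smul_eq_mul] at i1 i2
    simp only [Pi.sub_apply, sub_mul]
    rw [integral_sub i1 i2, h η hη hc, integral_step_mul_deriv hη hc]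
    ring

/-- If a function is continuous on `[a, b]` and differentiable inside with integrable derivative,
then its weak derivative is that derivative almost everywhere. -/
theorem weak_deriv_eq_ae {a b : ℝ} (hab : a ≤ b) {g g' w : ℝ → ℝ} (hg : ContinuousOn g (Icc a b))
    (hd : ∀ x ∈ Ioo a b, HasDerivAt g (g' x) x) (hi : IntervalIntegrable g' volume a b)
    (hw : IntegrableOn w (Ioo a b))
    (h : ∀ η : ℝ → ℝ, ContDiff ℝ (⊤ : ℕ∞) η → HasCompactSupport η → tsupport η ⊆ Ioo a b →
      ∫ z in Ioo a b, g z * deriv η z = -∫ z in Ioo a b, w z * η z) :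
    ∀ᵐ x, x ∈ Ioo a b → w x = g' x := by
  have hi' : IntegrableOn g' (Ioo a b) :=
    ((intervalIntegrable_iff_integrableOn_Ioc_of_le hab).1 hi).mono_set Ioo_subset_Ioc_self
  have key := isOpen_Ioo.ae_eq_zero_of_integral_contDiff_smul_eq_zero (U := Ioo a b)
    (μ := volume) (f := fun x => w x - g' x) (hw.sub hi').locallyIntegrableOn
    fun η hη hc hs => ?_
  · filter_upwards [key] with x hx hxm
    exact sub_eq_zero.1 (hx hxm)
  have hηd : ∀ x, HasDerivAt η (deriv η x) x := fun x =>
    (hη.differentiable (by simp)).differentiableAt.hasDerivAt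
  have hcd : Continuous (deriv η) := hη.continuous_deriv (by exact_mod_cast le_top)
  have hend : ∀ x ∉ Ioo a b, η x = 0 := fun x hx =>
    image_eq_zero_of_notMem_tsupport fun hx' => hx (hs hx')
  have hibp := intervalIntegral.integral_mul_deriv_eq_deriv_mul_of_hasDerivAt
    (a := a) (b := b) (u := g) (v := η) (u' := g') (v' := deriv η)
    (by rwa [uIcc_of_le hab]) hη.continuous.continuousOn
    (by rwa [min_eq_left hab, max_eq_right hab]) (fun x _ => hηd x) hi
    (hcd.intervalIntegrable _ _)
  rw [hend a (by simp), hend b (by simp), intervalIntegral.integral_of_le hab,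
    intervalIntegral.integral_of_le hab, integral_Ioc_eq_integral_Ioo,
    integral_Ioc_eq_integral_Ioo, h η hη hc hs] at hibp
  have hbd : ∃ C, ∀ x, ‖η x‖ ≤ C := hc.exists_bound_of_continuous hη.continuous
  obtain ⟨C, hC⟩ := hbd
  have i1 : IntegrableOn (fun x => w x * η x) (Ioo a b) :=
    hw.mul_bdd (c := C) hη.continuous.aestronglyMeasurable (Eventually.of_forall hC)
  have i2 : IntegrableOn (fun x => g' x * η x) (Ioo a b) :=
    hi'.mul_bdd (c := C) hη.continuous.aestronglyMeasurable (Eventually.of_forall hC)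
  have hset : ∫ x, η x • (w x - g' x) = ∫ x in Ioo a b, (w x * η x - g' x * η x) := by
    rw [← setIntegral_eq_integral_of_forall_compl_eq_zero (s := Ioo a b)
      fun x hx => by simp [hend x hx]]
    refine integral_congr_ae (Eventually.of_forall fun x => ?_)
    simp only [smul_eq_mul]
    ring
  rw [hset, integral_sub i1 i2]
  linarith

/-! ### Increasing solutions of autonomous equations -/

/-- An increasing solution of `φ' = g(φ)` cannot leave a point `x₀` near which
`g(y) ≤ K (y - x₀)`: by Gronwall's argument `(φ - x₀) exp(-K t)` does not increase. -/
theorem false_of_leave_equilibrium {φ g : ℝ → ℝ} {a b K : ℝ} (hab : a < b)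
    (hc : ContinuousOn φ (Icc a b)) (hm : StrictMonoOn φ (Icc a b))
    (hd : ∀ x ∈ Ioo a b, HasDerivAt φ (g (φ x)) x)
    (hK : ∀ᶠ y in 𝓝[>] φ a, g y ≤ K * (y - φ a)) : False := by
  have ha : a ∈ Icc a b := left_mem_Icc.2 hab.le
  have hlim : Tendsto φ (𝓝[>] a) (𝓝[>] φ a) := by
    refine tendsto_nhdsWithin_iff.2 ⟨?_, ?_⟩
    · exact (hc a ha).mono_left (nhdsWithin_le_of_mem (Icc_mem_nhdsGT hab))
    · filter_upwards [Ioc_mem_nhdsGT hab] with x hx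
      exact hm ha ⟨hx.1.le, hx.2⟩ hx.1
  obtain ⟨b', hb', hsub⟩ := (mem_nhdsGT_iff_exists_Ioo_subset' hab).1
    ((hlim.eventually hK).and (Ioo_mem_nhdsGT hab))
  have hb'a : a < b' := hb'
  set m := (a + b') / 2 with hmdef
  have ham : a < m := by rw [hmdef]; linarith
  have hmb : m < b := (hsub ⟨ham, by rw [hmdef]; linarith⟩).2.2
  have hder : ∀ x ∈ Ioo a m, HasDerivAt (fun t => (φ t - φ a) * Real.exp (-K * t))
      (g (φ x) * Real.exp (-K * x) + (φ x - φ a) * (Real.exp (-K * x) * (-K))) x := fun x hx => by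
    have h1 := (hd x ⟨hx.1, hx.2.trans hmb⟩).sub_const (φ a)
    have h2 : HasDerivAt (fun t : ℝ => -K * t) (-K) x := by
      simpa using (hasDerivAt_id x).const_mul (-K)
    exact h1.mul h2.exp
  have hanti : AntitoneOn (fun t => (φ t - φ a) * Real.exp (-K * t)) (Icc a m) := by
    refine antitoneOn_of_deriv_nonpos (convex_Icc _ _) ?_ ?_ ?_
    · have h1 : ContinuousOn φ (Icc a m) := hc.mono (Icc_subset_Icc_right hmb.le)
      exact (h1.sub continuousOn_const).mul (Continuous.continuousOn (by fun_prop))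
    · rw [interior_Icc]
      exact fun x hx => (hder x hx).differentiableAt.differentiableWithinAt
    · rw [interior_Icc]
      intro x hx
      rw [(hder x hx).deriv]
      have h1 : g (φ x) ≤ K * (φ x - φ a) :=
        (hsub ⟨hx.1, hx.2.trans (by rw [hmdef]; linarith)⟩).1
      have h2 := Real.exp_pos (-K * x)
      nlinarith
  have h1 := hanti (left_mem_Icc.2 ham.le) (right_mem_Icc.2 ham.le) ham.le
  have h2 : φ a < φ m := hm ha ⟨ham.le, hmb.le⟩ ham
  simp only [sub_self, zero_mul] at h1
  have h3 := mul_pos (sub_pos.2 h2) (Real.exp_pos (-K * m))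
  linarith

/-- Separation of variables: the time a solution of `φ' = g(φ)` takes between two values does not
depend on the solution, because `∫ 1/g` evaluated along it grows with unit speed. -/
theorem exists_time_map {g : ℝ → ℝ} {c e : ℝ} (hce : c < e) (hg : ContinuousOn g (Ioo c e))
    (hpos : ∀ x ∈ Ioo c e, 0 < g x) :
    ∃ H : ℝ → ℝ, ∀ (φ : ℝ → ℝ) (z b : ℝ), (∀ x ∈ Ioo z b, φ x ∈ Ioo c e) →
      (∀ x ∈ Ioo z b, HasDerivAt φ (g (φ x)) x) →
      ∃ C, ∀ x ∈ Ioo z b, H (φ x) = x + C := by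
  obtain ⟨x₀, hx₀⟩ := nonempty_Ioo.2 hce
  have hk : ContinuousOn (fun x => (g x)⁻¹) (Ioo c e) := hg.inv₀ fun x hx => (hpos x hx).ne'
  set H : ℝ → ℝ := fun x => ∫ t in x₀..x, (g t)⁻¹ with hH
  have hHd : ∀ x ∈ Ioo c e, HasDerivAt H (g x)⁻¹ x := fun x hx =>
    intervalIntegral.integral_hasDerivAt_right
      ((hk.mono (ordConnected_Ioo.uIcc_subset hx₀ hx)).intervalIntegrable)
      (hk.stronglyMeasurableAtFilter isOpen_Ioo x hx)
      (hk.continuousAt (isOpen_Ioo.mem_nhds hx))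
  refine ⟨H, fun φ z b hmem hd => ?_⟩
  have hd' : ∀ x ∈ Ioo z b, HasDerivAt (fun t => H (φ t) - t) 0 x := fun x hx => by
    have h1 := ((hHd _ (hmem x hx)).comp x (hd x hx)).sub (hasDerivAt_id x)
    rw [inv_mul_cancel₀ (hpos _ (hmem x hx)).ne', sub_self] at h1
    exact h1
  rcases (Ioo z b).eq_empty_or_nonempty with he | ⟨y, hy⟩
  · exact ⟨0, fun x hx => by simp [he] at hx⟩
  refine ⟨H (φ y) - y, fun x hx => ?_⟩
  have := isOpen_Ioo.is_const_of_deriv_eq_zero isPreconnected_Ioo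
    (fun x hx => (hd' x hx).differentiableAt.differentiableWithinAt)
    (fun x hx => (hd' x hx).deriv) hx hy
  linarith

/-- Two increasing solutions of `φ' = g(φ)`, `g > 0`, that run from the value `c` to the value `e`
and end at the same point start at the same point. -/
theorem start_unique {g φ₁ φ₂ : ℝ → ℝ} {c e z₁ z₂ b : ℝ} (hg : ContinuousOn g (Ioo c e))
    (hpos : ∀ x ∈ Ioo c e, 0 < g x) (hz₁ : z₁ < b) (hz₂ : z₂ < b)
    (hc₁ : ContinuousOn φ₁ (Icc z₁ b)) (hc₂ : ContinuousOn φ₂ (Icc z₂ b))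
    (hm₁ : StrictMonoOn φ₁ (Icc z₁ b)) (hm₂ : StrictMonoOn φ₂ (Icc z₂ b))
    (hd₁ : ∀ x ∈ Ioo z₁ b, HasDerivAt φ₁ (g (φ₁ x)) x)
    (hd₂ : ∀ x ∈ Ioo z₂ b, HasDerivAt φ₂ (g (φ₂ x)) x)
    (hl₁ : φ₁ z₁ = c) (hl₂ : φ₂ z₂ = c) (hr₁ : φ₁ b = e) (hr₂ : φ₂ b = e) : z₁ = z₂ := by
  have hmem : ∀ {φ : ℝ → ℝ} {z : ℝ}, z < b → StrictMonoOn φ (Icc z b) → φ z = c → φ b = e →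
      ∀ x ∈ Ioo z b, φ x ∈ Ioo c e := fun hz hm hl hr x hx =>
    ⟨hl ▸ hm (left_mem_Icc.2 hz.le) (Ioo_subset_Icc_self hx) hx.1,
      hr ▸ hm (Ioo_subset_Icc_self hx) (right_mem_Icc.2 hz.le) hx.2⟩
  have hsurj : ∀ {φ : ℝ → ℝ} {z : ℝ}, z < b → ContinuousOn φ (Icc z b) → φ z = c → φ b = e →
      ∀ v ∈ Ioo c e, ∃ x ∈ Ioo z b, φ x = v := fun hz hc hl hr v hv =>
    intermediate_value_Ioo hz.le hc (by rwa [hl, hr])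
  have hce : c < e := by
    rw [← hl₁, ← hr₁]
    exact hm₁ (left_mem_Icc.2 hz₁.le) (right_mem_Icc.2 hz₁.le) hz₁
  obtain ⟨H, hH⟩ := exists_time_map hce hg hpos
  obtain ⟨C₁, h₁⟩ := hH φ₁ z₁ b (hmem hz₁ hm₁ hl₁ hr₁) hd₁
  obtain ⟨C₂, h₂⟩ := hH φ₂ z₂ b (hmem hz₂ hm₂ hl₂ hr₂) hd₂
  -- the times at which the two solutions take equal values differ by a constant
  have s₁ : Ioo (z₁ + (C₁ - C₂)) (b + (C₁ - C₂)) ⊆ Ioo z₂ b := fun t ht => by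
    have ht' : t - (C₁ - C₂) ∈ Ioo z₁ b := ⟨by linarith [ht.1], by linarith [ht.2]⟩
    obtain ⟨s, hs, hs'⟩ := hsurj hz₂ hc₂ hl₂ hr₂ _ (hmem hz₁ hm₁ hl₁ hr₁ _ ht')
    have e1 := h₁ _ ht'
    have e2 := h₂ _ hs
    rw [hs', e1] at e2
    rwa [show t = s by linarith]
  have s₂ : Ioo (z₂ + (C₂ - C₁)) (b + (C₂ - C₁)) ⊆ Ioo z₁ b := fun t ht => by
    have ht' : t - (C₂ - C₁) ∈ Ioo z₂ b := ⟨by linarith [ht.1], by linarith [ht.2]⟩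
    obtain ⟨s, hs, hs'⟩ := hsurj hz₁ hc₁ hl₁ hr₁ _ (hmem hz₂ hm₂ hl₂ hr₂ _ ht')
    have e1 := h₂ _ ht'
    have e2 := h₁ _ hs
    rw [hs', e1] at e2
    rwa [show t = s by linarith]
  have r₁ := (Ioo_subset_Ioo_iff (by linarith)).1 s₁
  have r₂ := (Ioo_subset_Ioo_iff (by linarith)).1 s₂
  linarith [r₁.1, r₁.2, r₂.1, r₂.2]

/-! ### The froth boundary-value problem -/

/-- `φ` is a strictly increasing solution of `φ' = (j(φ; q) - s) / d(φ)` on `(z, zE)` from `phic`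
at `z` to `e` at the effluent level. -/
def IsFrothProfile (P : Column) (q s e z : ℝ) (φ : ℝ → ℝ) : Prop :=
  ContinuousOn φ (Icc z P.zE) ∧ StrictMonoOn φ (Icc z P.zE) ∧
    (∀ x ∈ Ioo z P.zE, HasDerivAt φ ((j P q (φ x) - s) / d P (φ x)) x) ∧
    φ z = P.phic ∧ φ P.zE = e

/-- Where the right-hand side of the froth equation is not positive, it is bounded by a linear
function of the distance to the right. At `phic` this uses the expressions of the flux and of the
capillarity that hold above `phic`. -/
theorem exists_linear_bound (P : Column) {q s x₀ : ℝ} (h0 : P.phic ≤ x₀) (h1 : x₀ < 1)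
    (hs : j P q x₀ ≤ s) :
    ∃ K, ∀ᶠ y in 𝓝[>] x₀, (j P q y - s) / d P y ≤ K * (y - x₀) := by
  have hx0 : 0 < x₀ := P.phic_pos.trans_le h0
  set n : ℝ → ℝ := fun y => y * (vdrain P * (1 - y) ^ (2 * P.nS + 1)) + q * y with hn
  have hnd : DifferentiableAt ℝ n x₀ := by
    have h2 : DifferentiableAt ℝ (fun y : ℝ => (1 - y) ^ (2 * P.nS + 1)) x₀ :=
      DifferentiableAt.rpow_const (by fun_prop) (Or.inl (by linarith))
    exact (differentiableAt_id.mul (h2.const_mul _)).add (differentiableAt_id.const_mul _)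
  obtain ⟨C, hC0, hC⟩ := hnd.hasDerivAt.isBigO_sub.exists_nonneg
  have hδ := dHigh_pos P hx0 h1
  refine ⟨C / (dHigh P x₀ / 2), ?_⟩
  have hdh : ∀ᶠ y in 𝓝 x₀, dHigh P x₀ / 2 < dHigh P y :=
    (continuous_dHigh P).continuousAt.eventually (Ioi_mem_nhds (by linarith))
  filter_upwards [nhdsWithin_le_nhds hC.bound, nhdsWithin_le_nhds hdh, self_mem_nhdsWithin]
    with y hy1 hy2 hy3
  have hy : x₀ < y := hy3
  have hjy : ∀ v, P.phic ≤ v → j P q v = n v := fun v hv => by simp only [j, jb_of_ge P hv, hn]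
  rw [hjy x₀ h0] at hs
  rw [d_of_gt P (h0.trans_lt hy), hjy y (h0.trans hy.le)]
  rw [Real.norm_eq_abs, Real.norm_eq_abs, abs_of_pos (sub_pos.2 hy)] at hy1
  have h3 : n y - s ≤ C * (y - x₀) := by linarith [le_abs_self (n y - n x₀)]
  have h4 : 0 ≤ C * (y - x₀) := mul_nonneg hC0 (by linarith)
  calc (n y - s) / dHigh P y ≤ C * (y - x₀) / dHigh P y :=
        div_le_div_of_nonneg_right h3 (by linarith)
    _ ≤ C * (y - x₀) / (dHigh P x₀ / 2) := div_le_div_of_nonneg_left h4 (by linarith) hy2.le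
    _ = C / (dHigh P x₀ / 2) * (y - x₀) := by ring

theorem IsFrothProfile.lt_flux {P : Column} {q s e z : ℝ} {φ : ℝ → ℝ}
    (h : IsFrothProfile P q s e z φ) (hz : z < P.zE) (he : e ≤ 1) {x : ℝ}
    (hx : x ∈ Ico P.phic e) : s < j P q x := by
  obtain ⟨hc, hm, hd, hl, hr⟩ := h
  by_contra! hle
  obtain ⟨t, ht, rfl⟩ : ∃ t ∈ Ico z P.zE, φ t = x :=
    intermediate_value_Ico hz.le hc (by rwa [hl, hr])
  obtain ⟨K, hK⟩ := exists_linear_bound P hx.1 (hx.2.trans_le he) hle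
  have hsub : Icc t P.zE ⊆ Icc z P.zE := Icc_subset_Icc_left ht.1
  exact false_of_leave_equilibrium ht.2 (hc.mono hsub) (hm.mono hsub)
    (fun y hy => hd y ⟨ht.1.trans_lt hy.1, hy.2⟩) hK

theorem IsFrothProfile.start_unique {P : Column} {q s e z z' : ℝ} {φ φ' : ℝ → ℝ}
    (h : IsFrothProfile P q s e z φ) (h' : IsFrothProfile P q s e z' φ') (hz : z < P.zE)
    (hz' : z' < P.zE) (he : e ≤ 1) : z' = z := by
  have hdpos : ∀ x ∈ Ioo P.phic e, 0 < dHigh P x := fun x hx =>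
    dHigh_pos P (P.phic_pos.trans hx.1) (hx.2.trans_le he)
  have hg : ContinuousOn (fun x => (j P q x - s) / d P x) (Ioo P.phic e) := by
    refine ContinuousOn.congr (f := fun x => (j P q x - s) / dHigh P x) ?_
      fun x hx => by rw [d_of_gt P hx.1]
    exact ((continuous_j P q).sub continuous_const).continuousOn.div
      (continuous_dHigh P).continuousOn fun x hx => (hdpos x hx).ne'
  have hpos : ∀ x ∈ Ioo P.phic e, 0 < (j P q x - s) / d P x := fun x hx => by
    rw [d_of_gt P hx.1]
    exact div_pos (sub_pos.2 (h.lt_flux hz he ⟨hx.1.le, hx.2⟩)) (hdpos x hx)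
  obtain ⟨hc, hm, hd, hl, hr⟩ := h
  obtain ⟨hc', hm', hd', hl', hr'⟩ := h'
  exact Flotation.start_unique hg hpos hz' hz hc' hc hm' hm hd' hd hl' hl hr' hr

/-! ### Consequences of the weak formulation in zone 2 and in the solids equation -/

theorem IsWeakDerivD.restrict {P : Column} {φ w g : ℝ → ℝ} (h : IsWeakDerivD P φ w) {a b : ℝ}
    (ha : P.zU ≤ a) (hb : b ≤ P.zE) (hg : ∀ z ∈ Ioo a b, D P (φ z) = g z) (η : ℝ → ℝ)
    (hη : ContDiff ℝ (⊤ : ℕ∞) η) (hc : HasCompactSupport η) (hs : tsupport η ⊆ Ioo a b) :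
    ∫ z in Ioo a b, g z * deriv η z = -∫ z in Ioo a b, w z * η z := by
  have hsub : Ioo a b ⊆ Ioo P.zU P.zE := Ioo_subset_Ioo ha hb
  have h1 := h.2 η hη hc (hs.trans hsub)
  rw [setIntegral_eq_of_subset_of_forall_sdiff_eq_zero (s := Ioo a b) measurableSet_Ioo hsub
      fun x hx => ?_,
    setIntegral_eq_of_subset_of_forall_sdiff_eq_zero (s := Ioo a b) measurableSet_Ioo hsub
      fun x hx => ?_] at h1
  · rw [← h1]
    exact setIntegral_congr_fun measurableSet_Ioo fun x hx => by simp only [hg x hx]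
  · rw [image_eq_zero_of_notMem_tsupport fun hx' => hx.2 (hs hx'), mul_zero]
  · have : deriv η x = 0 := by
      by_contra hne
      exact hx.2 (hs (support_deriv_subset hne))
    rw [this, mul_zero]

/-- A differentiable increasing profile starting at `phic` that satisfies the stationary equation
weakly solves the froth equation pointwise. -/
theorem isFrothProfile_of_weak {P : Column} {q s z : ℝ} {φ w : ℝ → ℝ} (hz : z < P.zE)
    (hc : ContinuousOn φ (Icc z P.zE)) (hm : StrictMonoOn φ (Icc z P.zE))
    (hdiff : DifferentiableOn ℝ φ (Ioo z P.zE)) (hl : φ z = P.phic) (hr : φ P.zE ≤ 1)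
    (hw : IntegrableOn w (Ioo z P.zE))
    (hweak : ∀ η : ℝ → ℝ, ContDiff ℝ (⊤ : ℕ∞) η → HasCompactSupport η →
      tsupport η ⊆ Ioo z P.zE →
      ∫ x in Ioo z P.zE, D P (φ x) * deriv η x = -∫ x in Ioo z P.zE, w x * η x)
    (hae : ∀ᵐ x, x ∈ Ioo z P.zE → w x = j P q (φ x) - s) :
    IsFrothProfile P q s (φ P.zE) z φ := by
  refine ⟨hc, hm, ?_, hl, rfl⟩
  have hval : ∀ x ∈ Ioo z P.zE, P.phic < φ x ∧ φ x < 1 := fun x hx =>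
    ⟨hl ▸ hm (left_mem_Icc.2 hz.le) (Ioo_subset_Icc_self hx) hx.1,
      (hm (Ioo_subset_Icc_self hx) (right_mem_Icc.2 hz.le) hx.2).trans_le hr⟩
  have hφd : ∀ x ∈ Ioo z P.zE, HasDerivAt φ (deriv φ x) x := fun x hx =>
    (hdiff.differentiableAt (isOpen_Ioo.mem_nhds hx)).hasDerivAt
  have hdpos : ∀ x ∈ Ioo z P.zE, 0 < d P (φ x) := fun x hx => by
    rw [d_of_gt P (hval x hx).1]
    exact dHigh_pos P (P.phic_pos.trans (hval x hx).1) (hval x hx).2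
  have hg : ContinuousOn (fun x => D P (φ x)) (Icc z P.zE) := (continuous_D P).comp_continuousOn hc
  have hgd : ∀ x ∈ Ioo z P.zE, HasDerivAt (fun x => D P (φ x)) (d P (φ x) * deriv φ x) x :=
    fun x hx => (hasDerivAt_D P (hval x hx).1).comp x (hφd x hx)
  have hnonneg : ∀ x ∈ Ioo z P.zE, 0 ≤ d P (φ x) * deriv φ x := fun x hx => by
    refine mul_nonneg (hdpos x hx).le ?_
    rw [← derivWithin_of_isOpen isOpen_Ioo hx]
    exact (hm.mono Ioo_subset_Icc_self).monotoneOn.derivWithin_nonneg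
  have hi : IntervalIntegrable (fun x => d P (φ x) * deriv φ x) volume z P.zE :=
    intervalIntegral.intervalIntegrable_deriv_of_nonneg (g := fun x => D P (φ x))
      (by rwa [uIcc_of_le hz.le]) (by rwa [min_eq_left hz.le, max_eq_right hz.le])
      (by rwa [min_eq_left hz.le, max_eq_right hz.le])
  have hae2 := weak_deriv_eq_ae hz.le hg hgd hi hw hweak
  have hn : ContinuousOn (fun x => j P q (φ x) - s) (Icc z P.zE) :=
    ((continuous_j P q).comp_continuousOn hc).sub continuousOn_const
  -- the fundamental theorem of calculus upgrades the equation from almost all to all heights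
  have hint : ∀ t ∈ Ioo z P.zE, ∫ x in z..t, (j P q (φ x) - s) = D P (φ t) - D P (φ z) := by
    intro t ht
    rw [← intervalIntegral.integral_eq_sub_of_hasDerivAt_of_le (f := fun x => D P (φ x)) ht.1.le
      (hg.mono (Icc_subset_Icc_right ht.2.le)) (fun x hx => hgd x ⟨hx.1, hx.2.trans ht.2⟩)
      (hi.mono_set (by
        rw [uIcc_of_le ht.1.le, uIcc_of_le hz.le]; exact Icc_subset_Icc_right ht.2.le))]
    refine intervalIntegral.integral_congr_ae ?_
    filter_upwards [hae, hae2] with x h1 h2 hx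
    rw [uIoc_of_le ht.1.le] at hx
    have hx' : x ∈ Ioo z P.zE := ⟨hx.1, hx.2.trans_lt ht.2⟩
    rw [← h1 hx', h2 hx']
  intro x hx
  have h1 : HasDerivAt (fun t => ∫ y in z..t, (j P q (φ y) - s)) (j P q (φ x) - s) x := by
    refine intervalIntegral.integral_hasDerivAt_right
      (ContinuousOn.intervalIntegrable (hn.mono ?_))
      ((hn.mono Ioo_subset_Icc_self).stronglyMeasurableAtFilter isOpen_Ioo x hx)
      (hn.continuousAt (Icc_mem_nhds hx.1 hx.2))
    rw [uIcc_of_le hx.1.le]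
    exact Icc_subset_Icc_right hx.2.le
  have h2 : HasDerivAt (fun t => ∫ y in z..t, (j P q (φ y) - s)) (d P (φ x) * deriv φ x) x := by
    refine ((hgd x hx).sub_const (D P (φ z))).congr_of_eventuallyEq ?_
    filter_upwards [isOpen_Ioo.mem_nhds hx] with t ht
    exact hint t ht
  rw [h1.unique h2, mul_div_cancel_left₀ _ (hdpos x hx).ne']
  exact hφd x hx

/-- The solids that enter at the feed level leave downwards: testing the solids equation with a
bump function at the feed level. -/
theorem solids_flux_zone_one {P : Column} {O : Operation} {φ ψ w : ℝ → ℝ} {u : ℝ}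
    (h : ∀ η : ℝ → ℝ, ContDiff ℝ (⊤ : ℕ∞) η → HasCompactSupport η →
      ∫ z, area P z * (-Ftilde P O (ψ z) (φ z) z + gam P z * (ψ z / (1 - φ z)) * w z) * deriv η z
        = -(O.QF * O.psiF * η P.zF))
    (hφ : ∀ z ∈ Ioo P.zU P.zF, φ z = 0) (hψ : ∀ z > P.zF, ψ z / (1 - φ z) = 0)
    (hu : ∀ z ∈ Ioo P.zU P.zF, ψ z / (1 - φ z) = u)
    (hw : ∀ᵐ z, z ∈ Ioo P.zU P.zF → w z = 0) :
    P.AU * f P (q1 P O.QU) u 0 = O.QF * O.psiF := by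
  have hr : 0 < P.zF - P.zU := sub_pos.2 P.zU_lt_zF
  let η : ContDiffBump P.zF := ⟨(P.zF - P.zU) / 2, P.zF - P.zU, by linarith, by linarith⟩
  have hηs : ContDiff ℝ (⊤ : ℕ∞) η := η.contDiff
  have hη1 : η P.zF = 1 := η.one_of_mem_closedBall (Metric.mem_closedBall_self η.rIn_pos.le)
  have key := h η hηs η.hasCompactSupport
  have hcongr : (fun z => area P z *
      (-Ftilde P O (ψ z) (φ z) z + gam P z * (ψ z / (1 - φ z)) * w z) * deriv η z)
      =ᵐ[volume] (Iic P.zF).indicator fun z => -(P.AU * f P (q1 P O.QU) u 0) * deriv η z := by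
    filter_upwards [hw, Measure.ae_ne volume P.zF, Measure.ae_ne volume P.zU] with z hwz hzF hzU
    rcases lt_or_gt_of_ne hzF with hlt | hgt
    · rw [indicator_of_mem (show z ∈ Iic P.zF from hlt.le)]
      rcases lt_or_gt_of_ne hzU with hltU | hgtU
      · have hd0 : deriv η z = 0 := by
          by_contra hne
          have := support_deriv_subset hne
          rw [η.tsupport_eq, Real.closedBall_eq_Icc] at this
          have h2 : P.zF - (P.zF - P.zU) ≤ z := this.1
          linarith
        rw [hd0, mul_zero, mul_zero]
      · have hm : z ∈ Ioo P.zU P.zF := ⟨hgtU, hlt⟩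
        have hE := not_le.2 (hlt.trans P.zF_lt_zE)
        have hu' := hu z hm
        rw [hwz hm, mul_zero, add_zero]
        rw [hφ z hm] at hu' ⊢
        simp only [Ftilde, zero_lt_one, if_true, hu', F, hE, not_le.2 hlt, hgtU.le, if_false, area]
        ring
    · rw [indicator_of_notMem (show z ∉ Iic P.zF from not_le.2 hgt)]
      have hF0 : Ftilde P O (ψ z) (φ z) z = 0 := by
        unfold Ftilde
        rw [hψ z hgt]
        split_ifs
        · simp [F, f, fb]
        · rfl
      rw [hF0, hψ z hgt]
      simp
  rw [integral_congr_ae hcongr, integral_indicator measurableSet_Iic, integral_const_mul,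
    η.hasCompactSupport.integral_Iic_deriv_eq (hηs.of_le (by exact_mod_cast le_top)), hη1] at key
  linarith

/-! ### The flux of the solids -/

theorem varphiMin_mem (P : Column) (q : ℝ) : varphiMin P q ∈ Icc (0 : ℝ) 1 := by
  have hn := P.nRZ_gt_one
  have h0 : 0 < inflf P := div_pos two_pos (by linarith)
  have h1 : inflf P ≤ 1 := by rw [inflf, div_le_one (by linarith)]; linarith
  unfold varphiMin
  split_ifs
  · exact ⟨h0.le, h1⟩
  · set S := {x | x ∈ Ioc (inflf P) 1 ∧ IsLocalMinOn (fun u => f P q u 0) (Icc 0 1) x}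
    rcases S.eq_empty_or_nonempty with he | ⟨x, hx⟩
    · simp [he]
    · exact ⟨le_csInf ⟨x, hx⟩ fun y hy => h0.le.trans hy.1.1.le,
        (csInf_le ⟨inflf P, fun y hy => hy.1.1.le⟩ hx).trans hx.1.2⟩

/-- `varphim` is the first point at which the flux reaches its value at the local minimum, so up to
it the flux does not exceed that value. -/
theorem f_le_of_mem_varphim (P : Column) {q u : ℝ} (hq : q ≤ 0) (hu : u ∈ Icc 0 (varphim P q)) :
    f P q u 0 ≤ f P q (varphiMin P q) 0 := by
  have hf0 : f P q 0 0 = 0 := by simp [f, fb]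
  have hcont : Continuous fun u => f P q u 0 := by
    have : Continuous fun u : ℝ => (1 - u) ^ P.nRZ :=
      (continuous_const.sub continuous_id).rpow_const fun _ => Or.inr (by linarith [P.nRZ_gt_one])
    unfold f fb
    fun_prop
  obtain ⟨hv0, hv1⟩ := varphiMin_mem P q
  have hpos : 0 ≤ f P q (varphiMin P q) 0 := by
    have h1 := Real.rpow_nonneg (sub_nonneg.2 hv1) P.nRZ
    have h2 := mul_nonneg hv0 (mul_nonneg P.vinf_pos.le h1)
    have h3 := mul_nonneg (neg_nonneg.2 hq) hv0
    simp only [f, fb, jb]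
    linarith
  by_contra! hlt
  obtain ⟨x, hx, hxe⟩ := intermediate_value_Icc hu.1 hcont.continuousOn
    (show f P q (varphiMin P q) 0 ∈ Icc (f P q 0 0) (f P q u 0) from ⟨by rwa [hf0], hlt.le⟩)
  have hu2 := hu.2
  unfold varphim at hu2
  have hbdd : BddBelow {x | x ∈ Icc 0 (inflf P) ∧ f P q x 0 = f P q (varphiMin P q) 0} :=
    ⟨0, fun y hy => hy.1.1⟩
  rcases eq_empty_or_nonempty {x | x ∈ Icc 0 (inflf P) ∧ f P q x 0 = f P q (varphiMin P q) 0}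
    with he | ⟨y, hy⟩
  · rw [he, Real.sInf_empty] at hu2
    rw [le_antisymm hu2 hu.1, hf0] at hlt
    linarith
  · have hxI : x ≤ inflf P := hx.2.trans (hu2.trans ((csInf_le hbdd hy).trans hy.1.2))
    have := csInf_le hbdd (show x ∈ _ from ⟨⟨hx.1, hxI⟩, hxe⟩)
    rw [le_antisymm hx.2 (hu2.trans this)] at hxe
    exact hlt.ne' hxe

/-! ### Discontinuities -/

theorem leftLim_G_zF (P : Column) (O : Operation) (v : ℝ) :
    Function.leftLim (G P O v) P.zF = P.AU * j P (q1 P O.QU) v := by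
  refine leftLim_eq_of_tendsto (tendsto_const_nhds.congr' ?_)
  filter_upwards [Ioo_mem_nhdsLT P.zU_lt_zF] with z hz
  simp [G, J, area, not_le.2 hz.2, hz.1.le, not_le.2 (hz.2.trans P.zF_lt_zE)]

theorem rightLim_G_zF (P : Column) (O : Operation) (v : ℝ) :
    Function.rightLim (G P O v) P.zF
      = P.AE * j P (q2 P O.QF O.QU) v - O.QF * O.phiF := by
  refine rightLim_eq_of_tendsto (tendsto_const_nhds.congr' ?_)
  filter_upwards [Ioo_mem_nhdsGT P.zF_lt_zE] with z hz
  simp [G, J, area, hz.1.le, not_le.2 hz.2]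

/-- The jump at the feed level from `0` to a value `p` on the increasing part of the flux of
zone 2 forces the intermediate value to be `p`, so that the flux of zone 1 is nonnegative at `p`
and has a zero above it. -/
theorem le_phiZ_of_interfaceAdmissible {P : Column} {O : Operation} {p : ℝ} (hp0 : 0 < p)
    (hp : p < phiMax P (q2 P O.QF O.QU))
    (hflux : j P (q2 P O.QF O.QU) p = sF P O.phiF O.QF)
    (h : InterfaceAdmissible (fun v => Function.leftLim (G P O v) P.zF)
      (fun v => Function.rightLim (G P O v) P.zF) 0 0 p) :
    p ≤ phiZ P (q1 P O.QU) := by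
  obtain ⟨u₀, hu₀, hL, hR⟩ := h.1 hp0
  simp only [leftLim_G_zF, rightLim_G_zF] at hL hR
  have h1 : j P (q2 P O.QF O.QU) p ≤ j P (q2 P O.QF O.QU) u₀ := by
    have h2 := hR u₀ (left_mem_Icc.2 hu₀.2)
    rw [hflux, sF, div_le_iff₀ P.AE_pos]
    linarith
  have hpu : p ≤ u₀ := by
    by_contra! hlt
    exact h1.not_gt (strictMonoOn_j P _ ⟨hu₀.1, (hlt.trans hp).le⟩ ⟨hp0.le, hp.le⟩ hlt)
  have h2 : 0 ≤ j P (q1 P O.QU) p := nonneg_of_mul_nonneg_right (hL p ⟨hp0.le, hpu⟩) P.AU_pos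
  have hq : q1 P O.QU ≤ 0 :=
    div_nonpos_of_nonpos_of_nonneg (neg_nonpos.2 O.QU_nonneg) P.AU_pos.le
  have hp1 : p ≤ 1 :=
    ((hp.trans_le (phiMax_le P _)).trans ((inflj_lt_phic P).trans P.phic_lt_one)).le
  obtain ⟨x, hx, hx0⟩ := intermediate_value_Icc' hp1 (continuous_j P (q1 P O.QU)).continuousOn
    (show (0 : ℝ) ∈ Icc _ _ from ⟨by rwa [j_one], h2⟩)
  exact hx.1.trans (le_csSup ⟨1, fun y hy => hy.1.2⟩ ⟨⟨hp0.le.trans hx.1, hx.2⟩, hx0⟩)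

end Flotation

end

theorem theorem1 (P : Flotation.Column) (O : Flotation.Operation) (φ ψ : ℝ → ℝ)
    (h : Flotation.IsDesiredSteadyState P O φ ψ) :
    -- (FIb)
    Flotation.phiBar2 P O.phiF O.QF O.QU ≤ Flotation.phiZ P (-O.QU / P.AU) ∧
    -- (FIas)
    P.AU * Flotation.f P (-O.QU / P.AU) (Flotation.varphiMin P (-O.QU / P.AU)) 0
      ≥ O.QF * O.psiF ∧
    -- (Froth1)
    (O.QF * (1 - O.phiF / P.phic) < O.QU - O.QW ∧ O.QU - O.QW ≤ O.QF * (1 - O.phiF)) ∧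
    -- (Froth2), with the location of the froth interface well defined
    ((∃! z, Flotation.IsFrothInterface P O.phiF O.QF O.QU O.QW z) ∧
      P.zF < Flotation.Zfr P O.phiF O.QF O.QU O.QW) ∧
    -- (Froth3)
    ((Flotation.phiMin P (Flotation.q2 P O.QF O.QU)
          < Flotation.phiE O.phiF O.QF O.QU O.QW →
        Flotation.sF P O.phiF O.QF < Flotation.j P (Flotation.q2 P O.QF O.QU)
          (Flotation.phiMin P (Flotation.q2 P O.QF O.QU))) ∧
      (Flotation.phiE O.phiF O.QF O.QU O.QW
          ≤ Flotation.phiMin P (Flotation.q2 P O.QF O.QU) →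
        Flotation.sF P O.phiF O.QF ≤ Flotation.j P (Flotation.q2 P O.QF O.QU)
          (Flotation.phiE O.phiF O.QF O.QU O.QW))) := by
  open Flotation in
  obtain ⟨⟨hmφ, -, hbd, w, hwD, hweak⟩, ⟨φU, hφU, hjump⟩, p, zfr, e, u₁, uU, φpar, hp0, hp, hFf,
    hfE, hparc, hparm, hpard, hparl, hparr, hφ1, hφ2, hφ3, hφ4, hφ5, hu₁, hψ2, hψ1, -⟩ := h
  have hUF := P.zU_lt_zF
  have hFE := P.zF_lt_zE
  have hQE := O.QE_pos
  have hAE := P.AE_pos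
  have hpI : p < inflj P := hp.trans_le (phiMax_le P _)
  have hpc : p < P.phic := hpI.trans (inflj_lt_phic P)
  have hφb : ∀ z, φ z ∈ Icc (0 : ℝ) 1 := fun z =>
    ⟨(hbd z).1, by linarith [(hbd z).2.1, (hbd z).2.2]⟩
  -- the total flux in each zone
  have hflux := ae_total_flux P O hmφ hφb hwD.1 hφ1 fun η h1 h2 => (hweak η h1 h2).1
  have hw1 : ∀ᵐ z, z ∈ Ioo P.zU P.zF → w z = 0 := by
    filter_upwards [hflux] with z hz hm
    have hA := P.AU_pos.ne'
    simpa [J, gam, area, hφ2 z hm, j_zero, not_le.2 hm.2, hm.1.le, hm.2.trans hFE,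
      not_le.2 (hm.2.trans hFE), hA] using hz
  have hw2 : ∀ᵐ z, z ∈ Ioo P.zF P.zE →
      w z = j P (q2 P O.QF O.QU) (φ z) - sF P O.phiF O.QF := by
    filter_upwards [hflux] with z hz hm
    simp only [J, gam, area, hm.1.le, hm.2, (hUF.trans hm.1).le, not_le.2 hm.2, if_true, if_false,
      and_self, one_mul] at hz
    rw [sF, ← hz]
    field_simp
    ring
  have he : e = phiE O.phiF O.QF O.QU O.QW := by
    have hne : (ae (volume.restrict (Ioi P.zE))).NeBot := by
      rw [ae_neBot, Ne, Measure.restrict_eq_zero]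
      simp
    obtain ⟨z, hz, hm⟩ := ((ae_restrict_of_ae hflux).and 
      (ae_restrict_mem (measurableSet_Ioi (a := P.zE)))).exists
    have hm' : P.zE < z := hm
    simp only [J, gam, area, hm'.le, (hFE.trans hm').le, hφ5 z hm', not_lt.2 hm'.le, and_false,
      if_true, if_false, zero_mul, sub_zero, qE] at hz
    rw [phiE, eq_div_iff hQE.ne', ← hz]
    field_simp
    ring
  have he1 : e ≤ 1 := by
    rw [← hφ5 (P.zE + 1) (by linarith)]
    exact (hφb _).2
  have hec : P.phic < e := by
    rw [← hparl, ← hparr]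
    exact hparm (left_mem_Icc.2 hfE.le) (right_mem_Icc.2 hfE.le) hfE
  -- below the froth the integrated capillarity is constant, so the convective flux balances the feed
  have hflp : j P (q2 P O.QF O.QU) p = sF P O.phiF O.QF := by
    have hz := weak_deriv_eq_ae (g := fun _ => D P p) (g' := fun _ => 0) hFf.le continuousOn_const
      (fun x _ => hasDerivAt_const x _) (by simp)
      (hwD.1.mono_set (Ioo_subset_Ioo hUF.le hfE.le))
      (hwD.restrict hUF.le hfE.le fun z hz => by rw [hφ3 z hz])
    have hne : (ae (volume.restrict (Ioo P.zF zfr))).NeBot := by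
      rw [ae_neBot, Ne, Measure.restrict_eq_zero]
      simpa using hFf
    obtain ⟨z, ⟨h1, h2⟩, hm⟩ := (((ae_restrict_of_ae hz).and (ae_restrict_of_ae hw2)).and
      (ae_restrict_mem (measurableSet_Ioo (a := P.zF) (b := zfr)))).exists
    have h3 := h2 ⟨hm.1, hm.2.trans hfE⟩
    rw [h1 hm, hφ3 z hm] at h3
    linarith
  have hfroth : IsFrothProfile P (q2 P O.QF O.QU) (sF P O.phiF O.QF) e zfr φpar := by
    rw [← hparr]
    refine isFrothProfile_of_weak hfE hparc hparm hpard hparl (hparr.trans_le he1)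
      (hwD.1.mono_set (Ioo_subset_Ioo_left (hUF.trans hFf).le))
      (hwD.restrict (hUF.trans hFf).le le_rfl fun z hz => by rw [hφ4 z hz]) ?_
    filter_upwards [hw2] with z hz hm
    rw [hz ⟨hFf.trans hm.1, hm.2⟩, hφ4 z hm]
  have hgt : ∀ x ∈ Ico P.phic e, sF P O.phiF O.QF < j P (q2 P O.QF O.QU) x :=
    fun x hx => hfroth.lt_flux hfE he1 hx
  -- without aggregates in zone 2 there would be none in the feed, hence no froth
  have hp_pos : 0 < p := by
    refine lt_of_le_of_ne hp0 fun hp00 => ?_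
    rw [← hp00, j_zero, sF, eq_comm, div_eq_zero_iff, or_iff_left hAE.ne'] at hflp
    rw [he, phiE, hflp, zero_div] at hec
    exact hec.not_gt P.phic_pos
  have hc0 : -O.QU * φU = 0 := by
    have : φU = 0 := tendsto_nhds_unique hφU (tendsto_const_nhds.congr' (by
      filter_upwards [self_mem_nhdsWithin] with z hz
      exact (hφ1 z hz).symm))
    rw [this, mul_zero]
  rw [hc0] at hjump
  have hFIb : p ≤ phiZ P (q1 P O.QU) := by
    refine le_phiZ_of_interfaceAdmissible hp_pos hp hflp
      ((hjump P.zF 0 p ?_ ?_).2 (Or.inr (Or.inl rfl)))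
    · refine tendsto_const_nhds.congr' ?_
      filter_upwards [Ioo_mem_nhdsLT hUF] with z hz
      exact (hφ2 z hz).symm
    · refine tendsto_const_nhds.congr' ?_
      filter_upwards [Ioo_mem_nhdsGT hFf] with z hz
      exact (hφ3 z hz).symm
  have hshock : ∀ v ∈ Ioo p P.phic, sF P O.phiF O.QF < j P (q2 P O.QF O.QU) v := by
    have hadm := (hjump zfr p P.phic ?_ ?_).1 ⟨(hUF.trans hFf).ne', hFf.ne', hfE.ne⟩
    · intro v hv
      have hG := hadm.1 hpc v hv
      simp only [G, J, area, hFf.le, (not_le.2 hfE), if_true, if_false] at hG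
      rw [sF, div_lt_iff₀ hAE]
      linarith
    · refine tendsto_const_nhds.congr' ?_
      filter_upwards [Ioo_mem_nhdsLT hFf] with z hz
      exact (hφ3 z hz).symm
    · have h1 : Tendsto φpar (𝓝[>] zfr) (𝓝 P.phic) := by
        rw [← hparl]
        exact (hparc zfr (left_mem_Icc.2 hfE.le)).mono_left
          (nhdsWithin_le_of_mem (Icc_mem_nhdsGT hfE))
      refine h1.congr' ?_
      filter_upwards [Ioo_mem_nhdsGT hfE] with z hz
      exact (hφ4 z hz).symm
  have hint : IsFrothInterface P O.phiF O.QF O.QU O.QW zfr :=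
    ⟨hfE, φpar, he ▸ hfroth⟩
  have huniq : ∀ z, IsFrothInterface P O.phiF O.QF O.QU O.QW z → z = zfr := by
    rintro z ⟨hz, φ', h'⟩
    rw [← he] at h'
    exact hfroth.start_unique h' hfE hz he1
  refine ⟨?_, ?_, ⟨?_, ?_⟩, ⟨⟨zfr, hint, huniq⟩, ?_⟩, ?_, ?_⟩
  · have hmem : p ∈ {x | x ∈ Ioc (0 : ℝ) 1 ∧
        sF P O.phiF O.QF = j P (q2 P O.QF O.QU) x} :=
      ⟨⟨hp_pos, (hpc.trans P.phic_lt_one).le⟩, hflp.symm⟩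
    exact (csInf_le ⟨0, fun x hx => hx.1.1.le⟩ hmem).trans hFIb
  · have hq : q1 P O.QU ≤ 0 :=
      div_nonpos_of_nonpos_of_nonneg (neg_nonpos.2 O.QU_nonneg) P.AU_pos.le
    rw [ge_iff_le, ← solids_flux_zone_one (fun η h1 h2 => (hweak η h1 h2).2) hφ2 hψ2 hψ1 hw1]
    exact mul_le_mul_of_nonneg_left (f_le_of_mem_varphim P hq hu₁) P.AU_pos.le
  · have hphic := P.phic_pos
    rw [he, phiE, lt_div_iff₀ hQE] at hec
    have h1 : O.QW + O.QF - O.QU < O.QF * O.phiF / P.phic := by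
      rw [lt_div_iff₀ hphic]
      linarith
    have h2 : O.QF * (1 - O.phiF / P.phic) = O.QF - O.QF * O.phiF / P.phic := by ring
    linarith
  · rw [he, phiE, div_le_one hQE] at he1
    linarith
  · have hex : ∃ z, IsFrothInterface P O.phiF O.QF O.QU O.QW z := ⟨zfr, hint⟩
    rw [Zfr, dif_pos hex, huniq _ hex.choose_spec]
    exact hFf
  · intro hlt
    rw [← he] at hlt
    rcases lt_or_ge (phiMin P (q2 P O.QF O.QU)) P.phic with hcase | hcase
    · exact hshock _ ⟨hpI.trans_le (inflj_le_phiMin P _), hcase⟩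
    · exact hgt _ ⟨hcase, hlt⟩
  · intro _
    rw [← he]
    refine ge_of_tendsto ((continuous_j P (q2 P O.QF O.QU)).continuousWithinAt (s := Iio e)) ?_
    filter_upwards [Ioo_mem_nhdsLT hec] with x hx
    exact (hgt x ⟨hx.1.le, hx.2⟩).le
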